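/- Let $n\ge 1$, let $\mathbf x=(x_1,\dots,x_n)$ and $\mathbf y=(y_1,\dots,y_n)$ be two alphabets and $t\neq 0$ a parameter, with values in a field $K$, generic in the sense that the $x_i$ are pairwise distinct, the $y_j$ are pairwise distinct, and $x_i\ne y_j$, $x_i\neq t y_j$ for all $i,j$ (e.g. independent indeterminates). Let $f$ be a function of one variable ($f:K\to K$). Write operators on functions of $\mathbf x$ on the right and put - $R(\mathbf a,\mathbf b)=\prod_{a\in\mathbf a}\prod_{b\in\mathbf b}(a-b)$ and $\Delta(\mathbf x)=\prod_{i<j}(x_j-x_i)$, and write $\mathbf x-x_1=\{x_2,\dots,x_n\}$; - $\theta$: the substitution $x_i\mapsto x_{i+1}$ with periodicity $x_{i+n}=x_i t^{-1}$, i.e. $x_i\mapsto x_{i+1}$ for $i<n$ and $x_n\mapsto x_1/t$; - $g\,\Cup_\omega=\sum_{w\in\mathfrak S_n}\Bigl(g\prod_{i<j}\frac{t x_i-x_j}{x_i-x_j}\Bigr)^w$ (the Euler–Poincaré characteristic of the flag manifold; $w$ permutes the $x_i$); - $g\,\partial_i=\dfrac{g-g^{s_i}}{x_i-x_{i+1}}$,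 where $s_i$ exchanges $x_i$ and $x_{i+1}$; - $F^1_n(\mathbf x,\mathbf y)=\dfrac{\prod_{i,j}(x_i-y_j)(x_i-ty_j)}{\Delta(\mathbf x)\Delta(\mathbf y)}\det\Bigl(\dfrac1{(x_i-y_j)(x_i-ty_j)}\Bigr)_{i,j=1}^n$ (the Gaudin function of level 1); - $[m]!=(1-t)(1-t^2)\cdots(1-t^m)$. Then $$ f(x_1)\,R(\mathbf x-x_1,\mathbf y)\,(1-t\theta)(1-t^2\theta)\cdots(1-t^{n-1}\theta)\,\Cup_\omega =\bigl(f(x_1)\,x_2\cdots x_n\,\partial_1\cdots\partial_{n-1}\bigr)\;F^1_n(\mathbf x,\mathbf y)\;\cdot\;(-1)^{\binom{n-1}{2}}\,t^{-\binom n2}\,[n-1]!\,. $$ -/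

import Mathlib

namespace Gaudin

/-- The resultant `R(a, b) = ∏_{α ∈ a} ∏_{β ∈ b} (α - β)` of two finite families (alphabets). -/
def resultant {K : Type*} [Field K] {ι κ : Type*} [Fintype ι] [Fintype κ]
    (a : ι → K) (b : κ → K) : K :=
  ∏ i, ∏ j, (a i - b j)

/-- The Vandermonde `Δ(x) = ∏_{i < j} (x_j - x_i)`. -/
def vandermonde {K : Type*} [Field K] {n : ℕ} (x : Fin n → K) : K :=
  ∏ i, ∏ j ∈ Finset.Ioi i, (x j - x i)

/-- The alphabet `y(1 + t + ⋯ + t^r) = {t^k y_j : 1 ≤ j ≤ n, 0 ≤ k ≤ r}`. -/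
def scaledAlphabet {K : Type*} [Field K] {n : ℕ} (t : K) (r : ℕ) (y : Fin n → K) :
    Fin n × Fin (r + 1) → K :=
  fun p => t ^ (p.2 : ℕ) * y p.1

/-- The Gaudin function of level `r`,
`F^r_n(x, y) = R(x, y(1+⋯+t^r)) / (Δ(x) Δ(y)) * det (1 / ((x_i - y_j)(x_i - t y_j)⋯(x_i - t^r y_j)))`. -/
noncomputable def gaudinF {K : Type*} [Field K] {n : ℕ} (t : K) (r : ℕ) (x y : Fin n → K) : K :=
  resultant x (scaledAlphabet t r y) / (vandermonde x * vandermonde y) *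
    (Matrix.of fun i j : Fin n => 1 / ∏ k ∈ Finset.range (r + 1), (x i - t ^ k * y j)).det

/-- The letters `x_{k+1}`, `k ∈ ℕ` (numbering from `0`), of the alphabet `x = (x_1, …, x_n)`
extended by the periodicity `x_{i+n} = x_i t⁻¹`. -/
noncomputable def periodicExt {K : Type*} [Field K] {n : ℕ} [NeZero n] (t : K) (x : Fin n → K)
    (k : ℕ) : K :=
  x (Fin.ofNat n k) * t⁻¹ ^ (k / n)

/-- The affine operation `θ` on functions of `x`: every `x_i` is replaced by `x_{i+1}`. -/
noncomputable def theta {K : Type*} [Field K] {n : ℕ} [NeZero n] (t : K)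
    (g : (Fin n → K) → K) : (Fin n → K) → K :=
  fun x => g fun i => periodicExt t x ((i : ℕ) + 1)

/-- The image of `g` under `(1 - tθ)(1 - t²θ)⋯(1 - t^mθ)` (operators act on the right). -/
noncomputable def thetaProd {K : Type*} [Field K] {n : ℕ} [NeZero n] (t : K)
    (g : (Fin n → K) → K) : ℕ → (Fin n → K) → K
  | 0 => g
  | m + 1 => fun x => thetaProd t g m x - t ^ (m + 1) * theta t (thetaProd t g m) x

/-- The Euler–Poincaré characteristic of the flag manifold, as the symmetrizer
`g ↦ ∑_w (g ∏_{i<j} (t x_i - x_j)/(x_i - x_j))^w`. -/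
noncomputable def eulerPoincare {K : Type*} [Field K] {n : ℕ} (t : K)
    (g : (Fin n → K) → K) : (Fin n → K) → K :=
  fun x => ∑ w : Equiv.Perm (Fin n),
    g (x ∘ w) * ∏ i, ∏ j ∈ Finset.Ioi i, (t * x (w i) - x (w j)) / (x (w i) - x (w j))

/-- The divided difference relative to the pair `(x_a, x_b)`. -/
noncomputable def dividedDiff {K : Type*} [Field K] {n : ℕ} (a b : Fin n)
    (g : (Fin n → K) → K) : (Fin n → K) → K :=
  fun x => (g x - g (x ∘ Equiv.swap a b)) / (x a - x b)

/-- The image of `g` under `∂_1 ∂_2 ⋯ ∂_m`, where `∂_1` acts first and `∂_i` is relative to the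
pair `(x_i, x_{i+1})`; it is used for `m ≤ n - 1` only. -/
noncomputable def dividedDiffProd {K : Type*} [Field K] {n : ℕ} [NeZero n]
    (g : (Fin n → K) → K) : ℕ → (Fin n → K) → K
  | 0 => g
  | m + 1 => dividedDiff (Fin.ofNat n m) (Fin.ofNat n (m + 1)) (dividedDiffProd g m)

/-- `[m]! = (1 - t)(1 - t²)⋯(1 - t^m)`. -/
def tFactorial {K : Type*} [Field K] (t : K) (m : ℕ) : K :=
  ∏ i ∈ Finset.Icc 1 m, (1 - t ^ i)

end Gaudin

namespace Gaudin

open Finset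

/-! Write `n = N + 1`. By the q-binomial theorem the operator product expands in powers of `θ`, and
`θ^k` puts `f` on the letter in position `k`, evaluates `R(·, y)` at `t⁻¹` times each earlier
letter, and at each later letter itself. Within each of these two blocks the weight is uniform, so
symmetrization only sees the pivot `a = x_p` and the set `A` of letters before it; the orderings
inside the blocks contribute t-factorials (`orderingSum_pivot`). These complete the q-binomial
coefficients, leaving a signed sum over all `A ⊆ x - a` (`eulerPoincare_thetaProd`).

On the other side the divided differences give `∑ f(x_p) ∏_{j≠p} x_j / (x_p - x_j)`
(`dividedDiffProd_eq_sum`), and `F^1_n` is symmetric in `x`. It remains to compare the coefficients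
of each `f(x_p)` (`sum_subsets_eq_gaudinF`).

The subset sum is a determinant expanded by multilinearity, with rows `u_i (t X_i)^k + v_i X_i^k`
(`det_add_scaled`). Partial fractions at the nodes `y_j` (`sub_mul_row_eq`) factor this matrix, up
to row and column scalings, through the Gaudin matrix and a Vandermonde matrix in `y`; the extra
row, indexed by `a`, becomes `(0, …, 0, 1)` (`det_sum_nodalWeight`). -/

/-! ### Sums over orderings of an alphabet -/

/-- The sum over the words `s₀ s₁ ⋯` of `m` distinct letters of `S` of
`∏ p, G p s_p * ∏ φ s_p r`, the last product being over the letters `r` of `S` other than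
`s₀, …, s_p`. -/
def orderingSum {ι R : Type*} [DecidableEq ι] [CommRing R] (φ : ι → ι → R) :
    ℕ → (ℕ → ι → R) → Finset ι → R
  | 0, _, _ => 1
  | m + 1, G, S => ∑ s ∈ S, G 0 s * (∏ r ∈ S.erase s, φ s r) *
      orderingSum φ m (fun p => G (p + 1)) (S.erase s)

theorem injective_comp_swap_succ {ι : Type*} {n : ℕ} {x : Fin (n + 1) → ι}
    (hx : Function.Injective x) (p : Fin (n + 1)) :
    Function.Injective fun i : Fin n => x (Equiv.swap 0 p i.succ) :=
  fun _ _ h => Fin.succ_injective _ ((Equiv.swap 0 p).injective (hx h))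

theorem image_erase_eq_image_swap_succ {ι : Type*} [DecidableEq ι] {n : ℕ} {x : Fin (n + 1) → ι}
    (hx : Function.Injective x) (p : Fin (n + 1)) :
    (univ.image x).erase (x p) = univ.image fun i : Fin n => x (Equiv.swap 0 p i.succ) := by
  ext a
  simp only [mem_erase, mem_image, mem_univ, true_and]
  constructor
  · rintro ⟨hne, j, rfl⟩
    have hj : Equiv.swap 0 p j ≠ 0 := by
      intro h
      apply hne
      have := congrArg (Equiv.swap 0 p) h
      rw [Equiv.swap_apply_self, Equiv.swap_apply_left] at this
      rw [this]
    obtain ⟨i, hi⟩ := Fin.exists_succ_eq.mpr hj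
    exact ⟨i, by rw [hi, Equiv.swap_apply_self]⟩
  · rintro ⟨i, rfl⟩
    refine ⟨fun h => ?_, _, rfl⟩
    have := congrArg (Equiv.swap 0 p) (hx h)
    rw [Equiv.swap_apply_self, Equiv.swap_apply_right] at this
    exact Fin.succ_ne_zero i this

/-- A permutation is the choice `p` of its first letter followed by a permutation `e` of the others.
The factors pairing `p` with the later letters run over all remaining letters, so they do not depend
on `e`. -/
theorem sum_perm_eq_orderingSum {ι R : Type*} [DecidableEq ι] [CommRing R] (φ : ι → ι → R)
    {n : ℕ} (G : ℕ → ι → R) (x : Fin n → ι) (hx : Function.Injective x) :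
    ∑ w : Equiv.Perm (Fin n), (∏ i : Fin n, G i (x (w i))) *
        ∏ i, ∏ j ∈ Ioi i, φ (x (w i)) (x (w j))
      = orderingSum φ n G (univ.image x) := by
  induction n generalizing G with
  | zero => simp [orderingSum]
  | succ n ih =>
    rw [orderingSum, sum_image hx.injOn, ← Equiv.Perm.decomposeFin.symm.sum_comp,
      Fintype.sum_prod_type]
    refine sum_congr rfl fun p _ => ?_
    have hx' := injective_comp_swap_succ hx p
    rw [image_erase_eq_image_swap_succ hx, ← ih (fun p => G (p + 1)) _ hx', prod_image hx'.injOn, mul_sum]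
    refine sum_congr rfl fun e _ => ?_
    simp only [Fin.prod_univ_succ, Equiv.Perm.decomposeFin_symm_apply_zero,
      Equiv.Perm.decomposeFin_symm_apply_succ, Fin.prod_Ioi_zero, Fin.prod_Ioi_succ,
      Fin.val_zero, Fin.val_succ]
    rw [Equiv.prod_comp e fun i : Fin n => φ (x p) (x (Equiv.swap 0 p i.succ))]
    ring

theorem sum_sum_powersetCard_erase {ι R : Type*} [DecidableEq ι] [AddCommMonoid R]
    (S : Finset ι) (k : ℕ) (F : ι → Finset ι → R) :
    ∑ s ∈ S, ∑ A ∈ (S.erase s).powersetCard k, F s A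
      = ∑ A ∈ S.powersetCard (k + 1), ∑ s ∈ A, F s (A.erase s) := by
  rw [sum_sigma', sum_sigma']
  refine sum_bij' (fun p _ => ⟨insert p.1 p.2, p.1⟩) (fun p _ => ⟨p.2, p.1.erase p.2⟩)
    ?_ ?_ ?_ ?_ ?_
  · rintro ⟨s, A⟩ h
    simp only [mem_sigma, mem_powersetCard, subset_erase] at h ⊢
    exact ⟨⟨insert_subset h.1 h.2.1.1, by rw [card_insert_of_notMem h.2.1.2, h.2.2]⟩,
      mem_insert_self _ _⟩
  · rintro ⟨A, s⟩ h
    simp only [mem_sigma, mem_powersetCard] at h ⊢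
    exact ⟨h.1.1 h.2, erase_subset_erase _ h.1.1, by rw [card_erase_of_mem h.2, h.1.2]; rfl⟩
  · rintro ⟨s, A⟩ h
    simp only [mem_sigma, mem_powersetCard, subset_erase] at h
    simp [erase_insert h.2.1.2]
  · rintro ⟨A, s⟩ h
    simp only [mem_sigma] at h
    simp [insert_erase h.2]
  · rintro ⟨s, A⟩ h
    simp only [mem_sigma, mem_powersetCard, subset_erase] at h
    simp [erase_insert h.2.1.2]

/-- When the first `k` positions carry the same weight `u`, only the set `A` of letters placed there
matters: the factors between `A` and its complement are common to all orderings of `A`, and `hφ`,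
applied at each size up to `k`, sums the internal ones. -/
theorem orderingSum_add {ι R : Type*} [DecidableEq ι] [CommRing R] {φ : ι → ι → R} {q : ℕ → R}
    (hφ : ∀ S : Finset ι, ∑ s ∈ S, ∏ r ∈ S.erase s, φ s r = q S.card) {u : ι → R} (k m : ℕ)
    (G : ℕ → ι → R) (hG : ∀ p < k, G p = u) (S : Finset ι) :
    orderingSum φ (k + m) G S = (∏ i ∈ range k, q (i + 1)) *
      ∑ A ∈ S.powersetCard k, (∏ a ∈ A, u a) * (∏ a ∈ A, ∏ b ∈ S \ A, φ a b) *
        orderingSum φ m (fun p => G (p + k)) (S \ A) := by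
  induction k generalizing G S with
  | zero => simp
  | succ k ih =>
    rw [show k + 1 + m = (k + m) + 1 by ring, orderingSum]
    have h1 : ∀ s ∈ S, G 0 s * (∏ r ∈ S.erase s, φ s r) *
        orderingSum φ (k + m) (fun p => G (p + 1)) (S.erase s)
        = ∑ A ∈ (S.erase s).powersetCard k, u s * (∏ r ∈ S.erase s, φ s r) *
          ((∏ i ∈ range k, q (i + 1)) * ((∏ a ∈ A, u a) *
            (∏ a ∈ A, ∏ b ∈ S.erase s \ A, φ a b) *
            orderingSum φ m (fun p => G (p + (k + 1))) (S.erase s \ A))) := by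
      intro s _
      rw [ih (fun p => G (p + 1)) (fun p hp => hG _ (by omega)), hG 0 (by omega), mul_sum, mul_sum]
      simp only [add_assoc]
    rw [sum_congr rfl h1, sum_sum_powersetCard_erase, mul_sum]
    refine sum_congr rfl fun A hA => ?_
    obtain ⟨hAS, hAk⟩ := mem_powersetCard.mp hA
    have h2 : ∀ s ∈ A, u s * (∏ r ∈ S.erase s, φ s r) *
          ((∏ i ∈ range k, q (i + 1)) * ((∏ a ∈ A.erase s, u a) *
            (∏ a ∈ A.erase s, ∏ b ∈ S.erase s \ A.erase s, φ a b) *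
            orderingSum φ m (fun p => G (p + (k + 1))) (S.erase s \ A.erase s)))
        = (∏ r ∈ A.erase s, φ s r) * ((∏ i ∈ range k, q (i + 1)) * ((∏ a ∈ A, u a) *
            (∏ a ∈ A, ∏ b ∈ S \ A, φ a b) *
            orderingSum φ m (fun p => G (p + (k + 1))) (S \ A))) := by
      intro s hs
      have e1 : S.erase s \ A.erase s = S \ A := by
        ext b
        simp only [mem_sdiff, mem_erase]
        constructor
        · rintro ⟨⟨h1, h2⟩, h3⟩; exact ⟨h2, fun h => h3 ⟨h1, h⟩⟩
        · rintro ⟨h1, h2⟩; exact ⟨⟨fun h => h2 (h ▸ hs), h1⟩, fun h => h2 h.2⟩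
      have e2 : ∏ r ∈ S.erase s, φ s r = (∏ r ∈ S \ A, φ s r) * ∏ r ∈ A.erase s, φ s r := by
        rw [← e1, prod_sdiff (erase_subset_erase s hAS)]
      rw [e1, e2, ← mul_prod_erase A u hs, ← mul_prod_erase A (fun a => ∏ b ∈ S \ A, φ a b) hs]
      ring
    -- The choice of the first letter of `A` is the only sum left; `hφ` evaluates it as `q (k + 1)`.
    rw [sum_congr rfl h2, ← sum_mul, hφ, hAk, prod_range_succ]
    ring

/-- Two uses of the block collapse: on the prefix of length `k`, and on the suffix of length `l`
with nothing after it. The pivot `s` is the single letter in between. -/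
theorem orderingSum_pivot {ι R : Type*} [DecidableEq ι] [CommRing R] {φ : ι → ι → R} {q : ℕ → R}
    (hφ : ∀ S : Finset ι, ∑ s ∈ S, ∏ r ∈ S.erase s, φ s r = q S.card) {u v F : ι → R} (k l : ℕ)
    (S : Finset ι) (hS : S.card = k + l + 1) :
    orderingSum φ (k + l + 1) (fun p => if p < k then u else if p = k then F else v) S
      = (∏ i ∈ range k, q (i + 1)) * (∏ i ∈ range l, q (i + 1)) *
        ∑ s ∈ S, F s * ∑ A ∈ (S.erase s).powersetCard k,
          (∏ a ∈ A, u a * φ a s) * (∏ b ∈ S.erase s \ A, v b * φ s b) *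
            ∏ a ∈ A, ∏ b ∈ S.erase s \ A, φ a b := by
  rw [add_assoc, orderingSum_add (u := u) hφ k (l + 1) _ (by intro p hp; simp [hp]), mul_assoc]
  congr 1
  have h1 : ∀ A ∈ S.powersetCard k, (∏ a ∈ A, u a) * (∏ a ∈ A, ∏ b ∈ S \ A, φ a b) *
        orderingSum φ (l + 1)
          (fun p => if p + k < k then u else if p + k = k then F else v) (S \ A)
      = ∑ s ∈ S \ A, (∏ i ∈ range l, q (i + 1)) * (F s *
          ((∏ a ∈ A, u a * φ a s) * (∏ b ∈ S.erase s \ A, v b * φ s b) *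
            ∏ a ∈ A, ∏ b ∈ S.erase s \ A, φ a b)) := by
    intro A hA
    obtain ⟨hAS, hAk⟩ := mem_powersetCard.mp hA
    rw [orderingSum, mul_sum]
    refine sum_congr rfl fun s hs => ?_
    have e1 : (S \ A).erase s = S.erase s \ A := by
      ext b; simp only [mem_sdiff, mem_erase]; tauto
    have hcard : (S.erase s \ A).card = l := by
      rw [← e1, card_erase_of_mem hs, card_sdiff_of_subset hAS, hS, hAk]; omega
    have h2 := orderingSum_add (u := v) hφ l 0
      (fun p => if p + 1 + k < k then u else if p + 1 + k = k then F else v)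
      (by
        intro p _
        have h3 : ¬ p + 1 + k < k := by omega
        simp [h3]) (S.erase s \ A)
    rw [add_zero, ← hcard, powersetCard_self, hcard] at h2
    simp only [sum_singleton, sdiff_self, orderingSum, mul_one] at h2
    rw [e1, h2]
    have h3 : ∀ a, ∏ b ∈ S \ A, φ a b = φ a s * ∏ b ∈ S.erase s \ A, φ a b := by
      intro a; rw [← e1, mul_prod_erase _ _ hs]
    simp only [h3, prod_mul_distrib]
    simp
    ring
  rw [sum_congr rfl h1, mul_sum]
  simp only [mul_sum]
  refine sum_comm' ?_
  intro A s
  simp only [mem_powersetCard, mem_sdiff, subset_erase]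
  tauto

/-! ### The q-binomial theorem -/

/-- The coefficients of the expansion of `(1 - tθ)(1 - t²θ)⋯(1 - t^mθ)` in powers of `θ`. -/
def thetaCoeff {R : Type*} [CommRing R] (t : R) : ℕ → ℕ → R
  | 0, 0 => 1
  | 0, _ + 1 => 0
  | m + 1, 0 => thetaCoeff t m 0
  | m + 1, k + 1 => thetaCoeff t m (k + 1) - t ^ (m + 1) * thetaCoeff t m k

theorem thetaCoeff_zero_right {R : Type*} [CommRing R] (t : R) (m : ℕ) :
    thetaCoeff t m 0 = 1 := by
  induction m with
  | zero => rfl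
  | succ m ih => rw [thetaCoeff, ih]

theorem thetaCoeff_eq_zero {R : Type*} [CommRing R] (t : R) {m k : ℕ} (h : m < k) :
    thetaCoeff t m k = 0 := by
  induction m generalizing k with
  | zero => obtain ⟨k, rfl⟩ := Nat.exists_eq_succ_of_ne_zero h.ne'; rfl
  | succ m ih =>
    obtain ⟨k, rfl⟩ := Nat.exists_eq_succ_of_ne_zero (by omega : k ≠ 0)
    rw [Nat.succ_eq_add_one, thetaCoeff, ih (by omega), ih (by omega)]
    ring

/-- The integer `1 + t + ⋯ + t^{m-1}`. -/
def tNumber {R : Type*} [CommRing R] (t : R) (m : ℕ) : R := ∑ i ∈ range m, t ^ i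

/-- The factorial built on `1 + t + ⋯ + t^{i-1}`. -/
def tNumberFactorial {R : Type*} [CommRing R] (t : R) (m : ℕ) : R :=
  ∏ i ∈ range m, tNumber t (i + 1)

theorem tNumber_add {R : Type*} [CommRing R] (t : R) (k l : ℕ) :
    tNumber t (k + l) = tNumber t k + t ^ k * tNumber t l := by
  simp only [tNumber, sum_range_add, pow_add, mul_sum]

/-- The q-binomial theorem, proved from the q-Pascal rule. It is kept free of division because the
t-factorials vanish at some roots of unity. -/
theorem thetaCoeff_mul_tNumberFactorial {R : Type*} [CommRing R] (t : R) (k l : ℕ) :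
    thetaCoeff t (k + l) k * (tNumberFactorial t k * tNumberFactorial t l)
      = (-1) ^ k * t ^ (k + 1).choose 2 * tNumberFactorial t (k + l) := by
  induction h : k + l generalizing k l with
  | zero =>
    obtain ⟨rfl, rfl⟩ : k = 0 ∧ l = 0 := by omega
    simp [thetaCoeff, tNumberFactorial]
  | succ m ih =>
    rcases k with _ | k
    · obtain rfl : l = m + 1 := by omega
      rw [thetaCoeff_zero_right]; simp [tNumberFactorial]
    · have ih2 := ih k l (by omega)
      have hchoose : (k + 1 + 1).choose 2 = (k + 1) + (k + 1).choose 2 := by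
        rw [Nat.choose_succ_succ' (k + 1) 1, Nat.choose_one_right]
      have hsucc : ∀ j, tNumberFactorial t (j + 1) = tNumberFactorial t j * tNumber t (j + 1) :=
        fun j => prod_range_succ _ _
      rcases l with _ | l
      · obtain rfl : m = k := by omega
        rw [thetaCoeff, thetaCoeff_eq_zero t (Nat.lt_succ_self m), hsucc, hchoose, pow_add]
        linear_combination (-t ^ (m + 1) * tNumber t (m + 1)) * ih2
      · have ih1 := ih (k + 1) l (by omega)
        have hm : m = k + l + 1 := by omega
        rw [hchoose, hsucc k, pow_add] at ih1
        rw [hsucc l] at ih2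
        rw [thetaCoeff, hsucc m, show m + 1 = (l + 1) + (k + 1) by omega, tNumber_add,
          hsucc l, hsucc k, hchoose, pow_add, pow_add]
        linear_combination (tNumber t (l + 1)) * ih1
          - t ^ (l + 1) * t ^ (k + 1) * tNumber t (k + 1) * ih2

/-! ### Summing the symmetrizer kernel over the first letter -/

open Polynomial in
/-- The polynomial `(∏ (tX - r) - ∏ (X - r)) / ((t - 1) X)`, written without division. -/
theorem exists_polynomial_scaling_quotient {K : Type*} [Field K] [DecidableEq K] (t : K)
    (S : Finset K) :
    ∃ p : K[X], p.degree < S.card ∧ (∀ k, k + 1 = S.card → p.coeff k = tNumber t S.card) ∧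
      (∀ z, (t - 1) * z * p.eval z = ∏ r ∈ S, (t * z - r) - ∏ r ∈ S, (z - r)) ∧
      ∀ s ∈ S, p.eval s = ∏ r ∈ S.erase s, (t * s - r) := by
  induction S using Finset.induction_on with
  | empty => exact ⟨0, by simp, by simp, by simp, by simp⟩
  | insert a S ha ih =>
    obtain ⟨p, hdeg, hcoeff, hev, hnode⟩ := ih
    -- From `(tz-a)∏(tz-r) - (z-a)∏(z-r) = (tz-a)(∏(tz-r) - ∏(z-r)) + (t-1)z ∏(z-r)`. The values at
    -- the nodes are carried along separately, since `(t-1)s` may be zero.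
    refine ⟨(C t * X - C a) * p + ∏ r ∈ S, (X - C r), ?_, ?_, ?_, ?_⟩
    · rw [card_insert_of_notMem ha]
      refine (degree_add_le _ _).trans_lt (max_lt ?_ ?_)
      · rcases eq_or_ne p 0 with rfl | hp
        · simp
        · have hlin : (C t * X - C a : K[X]).degree ≤ 1 := by
            refine (degree_sub_le _ _).trans (max_le ?_ ?_)
            · exact degree_C_mul_X_le t
            · exact degree_C_le.trans (by norm_num)
          rw [degree_mul]
          rw [degree_eq_natDegree hp] at hdeg ⊢
          refine (add_le_add_left hlin _).trans_lt ?_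
          have : p.natDegree < S.card := by exact_mod_cast hdeg
          exact_mod_cast (by omega : 1 + p.natDegree < S.card + 1)
      · rw [degree_prod]
        simp only [degree_X_sub_C, sum_const, nsmul_one]
        exact_mod_cast Nat.lt_succ_self _
    · intro k hk
      rw [card_insert_of_notMem ha] at hk ⊢
      obtain rfl : k = S.card := by omega
      have hmonic : (∏ r ∈ S, (X - C r) : K[X]).coeff S.card = 1 := by
        have h1 : (∏ r ∈ S, (X - C r) : K[X]).Monic := monic_prod_X_sub_C _ _
        have h2 : (∏ r ∈ S, (X - C r) : K[X]).natDegree = S.card := by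
          simp
        rw [← h2]; exact h1
      rw [coeff_add, hmonic, sub_mul, coeff_sub, mul_assoc, coeff_C_mul, coeff_C_mul,
        coeff_eq_zero_of_degree_lt hdeg]
      rcases hc : S.card with _ | c
      · simp [tNumber]
      · rw [coeff_X_mul, hcoeff c hc.symm, hc, tNumber, tNumber, geom_sum_succ (n := c + 1)]
        ring
    · intro z
      rw [prod_insert ha, prod_insert ha, eval_add, eval_mul, eval_prod]
      simp only [eval_sub, eval_mul, eval_C, eval_X]
      linear_combination (t * z - a) * hev z
    · intro s hs
      rw [eval_add, eval_mul, eval_prod]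
      simp only [eval_sub, eval_mul, eval_C, eval_X]
      rcases mem_insert.mp hs with rfl | hs
      · rw [erase_insert ha]
        linear_combination hev s
      · have hsa : a ≠ s := by rintro rfl; exact ha hs
        rw [prod_eq_zero hs (sub_self s), hnode s hs, erase_insert_of_ne hsa,
          prod_insert (fun h => ha (mem_of_mem_erase h)), add_zero]

/-- By Lagrange interpolation the sum is the coefficient of degree `S.card - 1` of the quotient
polynomial. This is the hypothesis `hφ` for the symmetrizer kernel. -/
theorem sum_prod_erase_eq_tNumber {K : Type*} [Field K] [DecidableEq K] (t : K) (S : Finset K) :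
    ∑ s ∈ S, ∏ r ∈ S.erase s, (t * s - r) / (s - r) = tNumber t S.card := by
  obtain ⟨p, hdeg, hcoeff, -, hnode⟩ := exists_polynomial_scaling_quotient t S
  rcases S.eq_empty_or_nonempty with rfl | hS
  · simp [tNumber]
  · rw [← hcoeff (S.card - 1) (Nat.sub_add_cancel hS.card_pos),
      Lagrange.coeff_eq_sum (v := id) (s := S) Function.injective_id.injOn hdeg]
    refine sum_congr rfl fun s hs => ?_
    rw [id, hnode s hs, prod_div_distrib]
    rfl

/-! ### Powers of `θ` -/

theorem periodicExt_periodicExt {K : Type*} [Field K] {n : ℕ} [NeZero n] (t : K) (x : Fin n → K)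
    (m : ℕ) :
    periodicExt t (fun i : Fin n => periodicExt t x ((i : ℕ) + 1)) m = periodicExt t x (m + 1) := by
  have hn : 0 < n := Nat.pos_of_ne_zero (NeZero.ne n)
  simp only [periodicExt, Fin.val_ofNat]
  have h1 : Fin.ofNat n (m % n + 1) = Fin.ofNat n (m + 1) :=
    Fin.ext (Nat.mod_add_mod m n 1)
  have h2 : (m % n + 1) / n + m / n = (m + 1) / n := by
    conv_rhs => rw [← Nat.mod_add_div m n, add_right_comm, Nat.add_mul_div_left _ _ hn]
  rw [h1, mul_assoc, ← pow_add, h2]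

theorem thetaProd_eq_sum {K : Type*} [Field K] {n : ℕ} [NeZero n] (t : K) (g : (Fin n → K) → K)
    (m : ℕ) (x : Fin n → K) :
    thetaProd t g m x = ∑ k ∈ range (m + 1),
      thetaCoeff t m k * g fun i => periodicExt t x ((i : ℕ) + k) := by
  induction m generalizing x with
  | zero =>
    have h : (fun i : Fin n => periodicExt t x (i : ℕ)) = x := by
      funext i
      simp [periodicExt, Nat.div_eq_of_lt i.isLt]
    simp [thetaProd, thetaCoeff, h]
  | succ m ih =>
    simp only [thetaProd, theta]
    rw [ih, ih, sum_range_succ' _ (m + 1)]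
    simp only [periodicExt_periodicExt, thetaCoeff, sub_mul, sum_sub_distrib, add_assoc, mul_sum,
      mul_assoc]
    have h : ∑ k ∈ range (m + 1), thetaCoeff t m k * g (fun i => periodicExt t x ((i : ℕ) + k))
        = ∑ k ∈ range (m + 1), thetaCoeff t m (k + 1) *
            g (fun i => periodicExt t x ((i : ℕ) + (k + 1)))
          + thetaCoeff t m 0 * g (fun i => periodicExt t x ((i : ℕ) + 0)) := by
      rw [← sum_range_succ' (fun k => thetaCoeff t m k *
          g (fun i => periodicExt t x ((i : ℕ) + k))), sum_range_succ _ (m + 1),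
        thetaCoeff_eq_zero t (Nat.lt_succ_self m), zero_mul, add_zero]
    rw [h]
    ring

/-- Since `k ≤ N`, a shift by `k` wraps around at most once. Reindexing by `i ↦ i + k` modulo `N +
1`, the wrapped letters are exactly those of index below `k`, and they acquire one factor `t⁻¹`. -/
theorem prod_periodicExt {K : Type*} [Field K] {N : ℕ} (t : K) (f p : K → K)
    (z : Fin (N + 1) → K) (k : ℕ) (hk : k ≤ N) :
    f (periodicExt t z (((0 : Fin (N + 1)) : ℕ) + k)) *
        ∏ i : {i : Fin (N + 1) // i ≠ 0}, p (periodicExt t z ((i : ℕ) + k))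
      = ∏ i : Fin (N + 1), (if (i : ℕ) < k then fun a => p (a * t⁻¹)
          else if (i : ℕ) = k then f else p) (z i) := by
  have hkn : k < N + 1 := by omega
  have hz : ∀ i : Fin (N + 1), periodicExt t z ((i : ℕ) + k)
      = if ((i + ⟨k, hkn⟩ : Fin (N + 1)) : ℕ) < k then z (i + ⟨k, hkn⟩) * t⁻¹
        else z (i + ⟨k, hkn⟩) := by
    intro i
    have h1 : Fin.ofNat (N + 1) ((i : ℕ) + k) = i + ⟨k, hkn⟩ := by
      ext; simp [Fin.val_add]
    rw [periodicExt, h1]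
    have hi := i.isLt
    rcases lt_or_ge ((i : ℕ) + k) (N + 1) with h | h
    · have h2 : ((i + ⟨k, hkn⟩ : Fin (N + 1)) : ℕ) = i + k := by
        rw [Fin.val_add, Fin.val_mk, Nat.mod_eq_of_lt h]
      rw [h2, Nat.div_eq_of_lt h, if_neg (by omega)]
      simp
    · have h2 : ((i + ⟨k, hkn⟩ : Fin (N + 1)) : ℕ) = i + k - (N + 1) := by
        rw [Fin.val_add, Fin.val_mk, Nat.mod_eq_sub_mod h, Nat.mod_eq_of_lt (by omega)]
      have h3 : ((i : ℕ) + k) / (N + 1) = 1 := Nat.div_eq_of_lt_le (by omega) (by omega)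
      rw [h2, h3, if_pos (by omega), pow_one]
  have hsub : ∏ i : {i : Fin (N + 1) // i ≠ 0}, p (periodicExt t z ((i : ℕ) + k))
      = ∏ i ∈ univ.erase (0 : Fin (N + 1)), p (periodicExt t z ((i : ℕ) + k)) :=
    (prod_subtype (univ.erase (0 : Fin (N + 1))) (by simp) fun i : Fin (N + 1) => p (periodicExt t z ((i : ℕ) + k))).symm
  rw [hsub, ← Equiv.prod_comp (Equiv.addRight (⟨k, hkn⟩ : Fin (N + 1))),
    ← mul_prod_erase univ _ (mem_univ (0 : Fin (N + 1)))]
  congr 1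
  · rw [hz]
    simp
  · refine prod_congr rfl fun i hi => ?_
    have hi0 : i ≠ 0 := (mem_erase.mp hi).1
    have hne : ((i + ⟨k, hkn⟩ : Fin (N + 1)) : ℕ) ≠ k := by
      intro h
      apply hi0
      have : i + ⟨k, hkn⟩ = ⟨k, hkn⟩ := Fin.ext h
      simpa using this
    rw [hz, Equiv.coe_addRight, if_neg hne]
    split_ifs <;> rfl

/-! ### The left side as a sum over pivots and subsets -/

theorem eulerPoincare_thetaProd {K : Type*} [Field K] [DecidableEq K] {N : ℕ} (t : K)
    (f p : K → K) (x : Fin (N + 1) → K) (hx : Function.Injective x) :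
    eulerPoincare t (thetaProd t (fun z : Fin (N + 1) → K =>
        f (z 0) * ∏ i : {i : Fin (N + 1) // i ≠ 0}, p (z i)) N) x
      = tNumberFactorial t N * ∑ s ∈ univ.image x, f s *
        ∑ A ∈ ((univ.image x).erase s).powerset, (-1) ^ A.card * t ^ (A.card + 1).choose 2 *
          ((∏ a ∈ A, p (a * t⁻¹) * ((t * a - s) / (a - s))) *
            (∏ b ∈ (univ.image x).erase s \ A, p b * ((t * s - b) / (s - b))) *
            ∏ a ∈ A, ∏ b ∈ (univ.image x).erase s \ A, (t * a - b) / (a - b)) := by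
  have hcard : (univ.image x).card = N + 1 := by
    rw [card_image_of_injective _ hx, card_univ, Fintype.card_fin]
  have hterm : ∀ k ∈ range (N + 1), ∑ w : Equiv.Perm (Fin (N + 1)),
      (f (periodicExt t (x ∘ w) (((0 : Fin (N + 1)) : ℕ) + k)) *
        ∏ i : {i : Fin (N + 1) // i ≠ 0}, p (periodicExt t (x ∘ w) ((i : ℕ) + k))) *
        ∏ i, ∏ j ∈ Ioi i, (t * x (w i) - x (w j)) / (x (w i) - x (w j))
      = tNumberFactorial t k * tNumberFactorial t (N - k) * ∑ s ∈ univ.image x, f s *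
        ∑ A ∈ ((univ.image x).erase s).powersetCard k,
          (∏ a ∈ A, p (a * t⁻¹) * ((t * a - s) / (a - s))) *
            (∏ b ∈ (univ.image x).erase s \ A, p b * ((t * s - b) / (s - b))) *
            ∏ a ∈ A, ∏ b ∈ (univ.image x).erase s \ A, (t * a - b) / (a - b) := by
    intro k hk
    have hkN : k ≤ N := by simpa [Nat.lt_succ_iff] using hk
    have h1 := orderingSum_pivot (φ := fun a b : K => (t * a - b) / (a - b)) (q := tNumber t)
      (sum_prod_erase_eq_tNumber t) (u := fun a => p (a * t⁻¹)) (v := p) (F := f) k (N - k)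
      (univ.image x) (by omega)
    rw [show k + (N - k) + 1 = N + 1 by omega] at h1
    rw [tNumberFactorial, tNumberFactorial, ← h1, ← sum_perm_eq_orderingSum _ _ x hx]
    refine sum_congr rfl fun w _ => ?_
    rw [prod_periodicExt t f p (x ∘ w) k hkN]
    rfl
  simp only [eulerPoincare, thetaProd_eq_sum, sum_mul, mul_assoc (thetaCoeff t N _)]
  rw [sum_comm]
  simp only [← mul_sum]
  -- The two block factorials turn the coefficient of `θ^k` into a monomial times a factorial
  -- independent of `k`, so the terms for all `k = A.card` merge into one sum over subsets.
  have hcoeff : ∀ k ∈ range (N + 1), thetaCoeff t N k *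
      (tNumberFactorial t k * tNumberFactorial t (N - k)) =
        tNumberFactorial t N * ((-1) ^ k * t ^ (k + 1).choose 2) := by
    intro k hk
    have hkN : k ≤ N := by simpa [Nat.lt_succ_iff] using hk
    have h := thetaCoeff_mul_tNumberFactorial t k (N - k)
    rw [Nat.add_sub_cancel' hkN] at h
    rw [h, mul_comm]
  have hsum : ∀ s ∈ univ.image x, f s *
        ∑ A ∈ ((univ.image x).erase s).powerset, (-1) ^ A.card * t ^ (A.card + 1).choose 2 *
          ((∏ a ∈ A, p (a * t⁻¹) * ((t * a - s) / (a - s))) *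
            (∏ b ∈ (univ.image x).erase s \ A, p b * ((t * s - b) / (s - b))) *
            ∏ a ∈ A, ∏ b ∈ (univ.image x).erase s \ A, (t * a - b) / (a - b))
      = ∑ k ∈ range (N + 1), (-1) ^ k * t ^ (k + 1).choose 2 * (f s *
        ∑ A ∈ ((univ.image x).erase s).powersetCard k,
          (∏ a ∈ A, p (a * t⁻¹) * ((t * a - s) / (a - s))) *
            (∏ b ∈ (univ.image x).erase s \ A, p b * ((t * s - b) / (s - b))) *
            ∏ a ∈ A, ∏ b ∈ (univ.image x).erase s \ A, (t * a - b) / (a - b)) := by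
    intro s hs
    rw [sum_powerset, card_erase_of_mem hs, hcard, Nat.add_sub_cancel, mul_sum]
    refine sum_congr rfl fun k _ => ?_
    rw [mul_left_comm]
    congr 1
    rw [mul_sum]
    refine sum_congr rfl fun A hA => ?_
    rw [(mem_powersetCard.mp hA).2]
  rw [sum_congr rfl hsum, sum_comm, mul_sum]
  refine sum_congr rfl fun k hk => ?_
  rw [hterm k hk, ← mul_assoc, hcoeff k hk, mul_assoc, mul_sum (univ.image x)]

/-! ### The subset sum as a determinant -/

theorem sum_pairs_mem_eq_choose {n : ℕ} (A : Finset (Fin n)) :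
    ∑ i, ∑ j ∈ Ioi i, (if i ∈ A ∧ j ∈ A then 1 else 0) = A.card.choose 2 := by
  have h := sum_sum_Ioi_add_eq_sum_sum_off_diag
    (fun i j : Fin n => if i ∈ A ∧ j ∈ A then 1 else 0)
  have h1 : ∑ i : Fin n, ∑ j ∈ {i}ᶜ, (if j ∈ A ∧ i ∈ A then 1 else 0)
      = A.card * (A.card - 1) := by
    rw [← sum_filter_add_sum_filter_not univ (· ∈ A)]
    have h2 : ∀ i ∈ univ.filter (· ∈ A), ∑ j ∈ ({i}ᶜ : Finset (Fin n)),
        (if j ∈ A ∧ i ∈ A then 1 else 0) = A.card - 1 := by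
      intro i hi
      have hi : i ∈ A := by simpa using hi
      rw [← card_erase_of_mem hi, ← card_filter]
      congr 1
      ext j
      simp [hi, and_comm]
    rw [sum_congr rfl h2, sum_eq_zero (s := univ.filter (· ∉ A))]
    · simp
    · intro i hi
      have hi : i ∉ A := by simpa using hi
      simp [hi]
  rw [h1] at h
  rw [Nat.choose_two_right, ← h]
  simp only [sum_add_distrib, and_comm]
  omega

/-- Scaling the letters of `A` by `t` changes a Vandermonde factor by `t` if both letters lie in
`A`, and by the kernel if exactly one does. The kernel ratio is unchanged when both differences
change sign, so the order of the two indices is irrelevant. -/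
theorem prod_Ioi_piecewise {K : Type*} [Field K] {n : ℕ} (t : K) (x : Fin n → K)
    (hx : Function.Injective x) (A : Finset (Fin n)) :
    ∏ i, ∏ j ∈ Ioi i, (A.piecewise (fun i => t * x i) x j - A.piecewise (fun i => t * x i) x i)
      = vandermonde x * (t ^ A.card.choose 2 *
        ∏ i ∈ A, ∏ j ∈ Aᶜ, (t * x i - x j) / (x i - x j)) := by
  set σ : Fin n → Fin n → K := fun i j =>
    if i ∈ A ∧ j ∉ A then (t * x i - x j) / (x i - x j) else 1 with hσ
  have hpair : ∀ i j, i ≠ j →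
      A.piecewise (fun i => t * x i) x j - A.piecewise (fun i => t * x i) x i
        = (x j - x i) * (t ^ (if i ∈ A ∧ j ∈ A then 1 else 0) * (σ j i * σ i j)) := by
    intro i j hij
    have h1 : x i - x j ≠ 0 := sub_ne_zero.mpr fun h => hij (hx h)
    have h2 : x j - x i ≠ 0 := sub_ne_zero.mpr fun h => hij (hx h).symm
    by_cases hi : i ∈ A <;> by_cases hj : j ∈ A <;> simp [hσ, hi, hj]
    · ring
    · field_simp
      ring
    · field_simp
  have hprod : ∏ i, ∏ j ∈ Ioi i, (σ j i * σ i j)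
      = ∏ i ∈ A, ∏ j ∈ Aᶜ, (t * x i - x j) / (x i - x j) := by
    have hdiag : ∀ i : Fin n, ∏ j ∈ ({i}ᶜ : Finset (Fin n)), σ j i = ∏ j, σ j i := by
      intro i
      refine prod_subset (subset_univ _) fun j _ hj => ?_
      obtain rfl : j = i := by simpa using hj
      simp [hσ]
    rw [prod_prod_Ioi_mul_eq_prod_prod_off_diag, prod_congr rfl fun i _ => hdiag i, prod_comm,
      ← prod_subset (subset_univ A) fun i _ hi => prod_eq_one fun j _ => by simp [hσ, hi]]
    refine prod_congr rfl fun i hi => ?_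
    rw [← prod_subset (subset_univ Aᶜ) fun j _ hj => by simp_all]
    refine prod_congr rfl fun j hj => ?_
    simp_all
  rw [← hprod, ← sum_pairs_mem_eq_choose A, ← prod_pow_eq_pow_sum, vandermonde]
  simp only [← prod_pow_eq_pow_sum, ← prod_mul_distrib]
  exact prod_congr rfl fun i _ => prod_congr rfl fun j hj =>
    hpair i j (mem_Ioi.mp hj).ne

/-- Each row is a sum of two; multilinearity gives, for every `A`, the Vandermonde determinant of
the alphabet scaled on `A`. -/
theorem det_add_scaled {K : Type*} [Field K] {n : ℕ} (t : K) (x u v : Fin n → K)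
    (hx : Function.Injective x) :
    (Matrix.of fun i j : Fin n => u i * (t * x i) ^ (j : ℕ) + v i * x i ^ (j : ℕ)).det
      = vandermonde x * ∑ A : Finset (Fin n), (∏ i ∈ A, u i) * (∏ i ∈ Aᶜ, v i) *
        (t ^ A.card.choose 2 * ∏ i ∈ A, ∏ j ∈ Aᶜ, (t * x i - x j) / (x i - x j)) := by
  have h := (Matrix.detRowAlternating (R := K) (n := Fin n)).toMultilinearMap.map_add_univ
    (fun i j => u i * (t * x i) ^ (j : ℕ)) (fun i j => v i * x i ^ (j : ℕ))
  refine Eq.trans h ?_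
  rw [mul_sum]
  refine sum_congr rfl fun A _ => ?_
  have h1 : (A.piecewise (fun i (j : Fin n) => u i * (t * x i) ^ (j : ℕ))
        (fun i j => v i * x i ^ (j : ℕ)) : Matrix (Fin n) (Fin n) K)
      = Matrix.of fun i j => A.piecewise u v i *
        Matrix.vandermonde (A.piecewise (fun i => t * x i) x) i j := by
    ext i j
    by_cases hi : i ∈ A <;> simp [hi, Matrix.vandermonde]
  have h2 := Matrix.det_mul_column (A.piecewise u v)
    (Matrix.vandermonde (A.piecewise (fun i => t * x i) x))
  rw [← h1, Matrix.det_vandermonde, prod_Ioi_piecewise t x hx A] at h2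
  refine Eq.trans h2 ?_
  rw [prod_piecewise]
  simp only [univ_inter, ← compl_eq_univ_sdiff]
  ring

/-! ### Partial fractions at `y` and the Gaudin determinant -/

theorem prod_nodalWeight_mul_vandermonde_sq {K : Type*} [Field K] {n : ℕ} (y : Fin n → K)
    (hy : Function.Injective y) :
    (∏ j, Lagrange.nodalWeight univ y j) * (vandermonde y * vandermonde y)
      = (-1) ^ n.choose 2 := by
  have h1 : ∏ j, ∏ l ∈ univ.erase j, (y j - y l)
      = (-1) ^ n.choose 2 * (vandermonde y * vandermonde y) := by
    have h2 := prod_prod_Ioi_mul_eq_prod_prod_off_diag fun i j : Fin n => y j - y i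
    have h3 : ∀ j, univ.erase j = ({j}ᶜ : Finset (Fin n)) := fun j => by ext; simp
    simp only [h3]
    rw [← h2]
    have h4 := sum_pairs_mem_eq_choose (univ : Finset (Fin n))
    simp only [mem_univ, and_self, if_true, card_univ, Fintype.card_fin] at h4
    rw [← h4, ← prod_pow_eq_pow_sum, vandermonde]
    simp only [← prod_pow_eq_pow_sum, ← prod_mul_distrib]
    refine prod_congr rfl fun i _ => prod_congr rfl fun j _ => ?_
    ring
  have h5 : ∏ j, ∏ l ∈ univ.erase j, (y j - y l) ≠ 0 := by
    refine prod_ne_zero_iff.mpr fun j _ => prod_ne_zero_iff.mpr fun l hl => ?_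
    exact sub_ne_zero.mpr fun h => (mem_erase.mp hl).1 (hy h).symm
  simp only [Lagrange.nodalWeight, prod_inv_distrib]
  rw [inv_mul_eq_iff_eq_mul₀ h5, h1, mul_right_comm, ← pow_add, Even.neg_one_pow ⟨_, rfl⟩, one_mul]

/-- The sum is the coefficient of degree `N` of the interpolant of `X^k`, which is `X^k` itself. -/
theorem sum_nodalWeight_mul_pow {K : Type*} [Field K] {N : ℕ} (y : Fin (N + 1) → K)
    (hy : Function.Injective y) (k : ℕ) (hk : k ≤ N) :
    ∑ j, Lagrange.nodalWeight univ y j * y j ^ k = if k = N then 1 else 0 := by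
  have h := Lagrange.coeff_eq_sum (s := univ) (v := y) hy.injOn (P := Polynomial.X ^ k)
    (by
      rw [Polynomial.degree_X_pow, card_univ, Fintype.card_fin]
      exact_mod_cast Nat.lt_succ_of_le hk)
  rw [Polynomial.coeff_X_pow, card_univ, Fintype.card_fin, Nat.add_sub_cancel] at h
  rw [if_congr eq_comm rfl rfl, h]
  refine sum_congr rfl fun j _ => ?_
  rw [Lagrange.nodalWeight, prod_inv_distrib, Polynomial.eval_pow, Polynomial.eval_X,
    div_eq_inv_mul]

theorem pow_eq_prod_mul_sum_nodalWeight {K : Type*} [Field K] {N : ℕ} (y : Fin (N + 1) → K)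
    (hy : Function.Injective y) (k : ℕ) (hk : k ≤ N) (x : K) (hx : ∀ j, x ≠ y j) :
    x ^ k = (∏ j, (x - y j)) *
      ∑ j, Lagrange.nodalWeight univ y j * y j ^ k * (x - y j)⁻¹ := by
  have h := Lagrange.eq_interpolate (s := univ) (v := y) hy.injOn (f := Polynomial.X ^ k)
    (by
      rw [Polynomial.degree_X_pow, card_univ, Fintype.card_fin]
      exact_mod_cast Nat.lt_succ_of_le hk)
  have h2 := congrArg (Polynomial.eval x) h
  rw [Lagrange.eval_interpolate_not_at_node _ fun j _ => hx j, Lagrange.eval_nodal] at h2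
  simp only [Polynomial.eval_pow, Polynomial.eval_X] at h2
  rw [h2]
  congr 1
  exact sum_congr rfl fun j _ => by ring

theorem pow_mul_pow_eq_prod_mul_sum_nodalWeight {K : Type*} [Field K] {N : ℕ}
    (y : Fin (N + 1) → K) (hy : Function.Injective y) (t : K) (ht : t ≠ 0) (k : ℕ) (hk : k ≤ N)
    (x : K) (hx : ∀ j, x ≠ t * y j) :
    t ^ N * x ^ k = t ^ k * (∏ j, (x - t * y j)) *
      ∑ j, Lagrange.nodalWeight univ y j * y j ^ k * (x - t * y j)⁻¹ := by
  have hz : ∀ j, x / t ≠ y j := fun j h => hx j (by rw [← h]; field_simp)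
  have h := pow_eq_prod_mul_sum_nodalWeight y hy k hk (x / t) hz
  have h1 : ∀ j, x / t - y j = t⁻¹ * (x - t * y j) := fun j => by field_simp
  simp only [h1, prod_mul_distrib, prod_const, card_univ, Fintype.card_fin, mul_inv, inv_inv,
    mul_left_comm _ t, ← mul_sum] at h
  rw [div_pow, div_eq_iff (pow_ne_zero _ ht)] at h
  rw [h, pow_succ, inv_pow]
  field_simp

/-- The partial fraction expansion behind the factorization of the determinant. -/
theorem sub_mul_row_eq {K : Type*} [Field K] {N : ℕ} (y : Fin (N + 1) → K)
    (hy : Function.Injective y) (t : K) (ht : t ≠ 0) (k : ℕ) (hk : k < N) (a x : K)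
    (hx : ∀ j, x ≠ y j) (hxt : ∀ j, x ≠ t * y j) :
    (a - x) * (t ^ N * (t * a - x) * (∏ j, (x - y j)) * x ^ k
        - t ^ k * (a - t * x) * (∏ j, (x - t * y j)) * x ^ k)
      = ((t - 1) * t ^ k) * (((∏ j, (x - y j)) * (∏ j, (x - t * y j)) * x) *
        ∑ j, 1 / ((x - y j) * (x - t * y j)) * ((a - y j) * (a - t * y j)) *
          (Lagrange.nodalWeight univ y j * y j ^ k)) := by
  set P := ∏ j, (x - y j) with hP
  set Q := ∏ j, (x - t * y j) with hQ
  set w := Lagrange.nodalWeight univ y with hw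
  have s0 := pow_eq_prod_mul_sum_nodalWeight y hy k hk.le x hx
  have s1 := pow_eq_prod_mul_sum_nodalWeight y hy (k + 1) hk x hx
  have t0 := pow_mul_pow_eq_prod_mul_sum_nodalWeight y hy t ht k hk.le x hxt
  have t1 := pow_mul_pow_eq_prod_mul_sum_nodalWeight y hy t ht (k + 1) hk x hxt
  have z0 := sum_nodalWeight_mul_pow y hy k hk.le
  -- Strict inequality `k < N` makes this moment vanish, which removes the term `a * ∑ j, w j * y j
  -- ^ k` from `hsum`.
  rw [if_neg hk.ne] at z0
  rw [← hP, ← hw] at s0 s1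
  rw [← hQ, ← hw] at t0 t1
  rw [← hw] at z0
  have hsum : (a - x) * (t * a * ∑ j, w j * y j ^ k * (x - t * y j)⁻¹
        - t * ∑ j, w j * y j ^ (k + 1) * (x - t * y j)⁻¹
        - a * ∑ j, w j * y j ^ k * (x - y j)⁻¹ + t * ∑ j, w j * y j ^ (k + 1) * (x - y j)⁻¹)
      = (t - 1) * (x * ∑ j, 1 / ((x - y j) * (x - t * y j)) * ((a - y j) * (a - t * y j)) *
          (w j * y j ^ k) - a * ∑ j, w j * y j ^ k) := by
    simp only [mul_sum, ← sum_sub_distrib, ← sum_add_distrib]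
    refine sum_congr rfl fun j _ => ?_
    have h1 := sub_ne_zero.mpr (hx j)
    have h2 := sub_ne_zero.mpr (hxt j)
    field_simp
    ring
  rw [z0, mul_zero, sub_zero] at hsum
  have e : t ^ N * (t * a - x) * P * x ^ k - t ^ k * (a - t * x) * Q * x ^ k
      = t ^ k * P * Q * (t * a * ∑ j, w j * y j ^ k * (x - t * y j)⁻¹
        - t * ∑ j, w j * y j ^ (k + 1) * (x - t * y j)⁻¹
        - a * ∑ j, w j * y j ^ k * (x - y j)⁻¹
        + t * ∑ j, w j * y j ^ (k + 1) * (x - y j)⁻¹) := by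
    linear_combination (t * a * P) * t0 - P * t1 - (t ^ k * a * Q) * s0 + (t ^ k * t * Q) * s1
  rw [e]
  linear_combination (t ^ k * P * Q) * hsum

/-- The columns of the Gaudin matrix are scaled so that the row of `a` becomes all ones. Multiplying
by the weighted Vandermonde matrix turns that row into the moments `(0, …, 0, 1)`, and Laplace
expansion along it leaves the stated minor. -/
theorem det_sum_nodalWeight {K : Type*} [Field K] {N : ℕ} (y : Fin (N + 1) → K)
    (hy : Function.Injective y) (t a : K) (X : Fin N → K) (ha : ∀ j, a ≠ y j)
    (hat : ∀ j, a ≠ t * y j) :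
    (Matrix.of fun i k : Fin N => ∑ j, 1 / ((X i - y j) * (X i - t * y j)) *
        ((a - y j) * (a - t * y j)) * (Lagrange.nodalWeight univ y j * y j ^ (k : ℕ))).det
      = (-1) ^ N * (∏ j, ((a - y j) * (a - t * y j))) *
        (Matrix.of fun i j : Fin (N + 1) =>
          1 / (((Fin.cons a X : Fin (N + 1) → K) i - y j) *
            ((Fin.cons a X : Fin (N + 1) → K) i - t * y j))).det *
        ((∏ j, Lagrange.nodalWeight univ y j) * vandermonde y) := by
  set M : Matrix (Fin (N + 1)) (Fin (N + 1)) K := Matrix.of fun i j =>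
    1 / (((Fin.cons a X : Fin (N + 1) → K) i - y j) *
      ((Fin.cons a X : Fin (N + 1) → K) i - t * y j)) with hM
  set E : Matrix (Fin (N + 1)) (Fin (N + 1)) K :=
    Matrix.of fun i j => ((a - y j) * (a - t * y j)) * M i j with hE
  set V : Matrix (Fin (N + 1)) (Fin (N + 1)) K :=
    Matrix.of fun j k => Lagrange.nodalWeight univ y j * Matrix.vandermonde y j k with hV
  have hdet : (E * V).det = (∏ j, ((a - y j) * (a - t * y j))) * M.det *
      ((∏ j, Lagrange.nodalWeight univ y j) * vandermonde y) := by
    rw [Matrix.det_mul, hE, hV, Matrix.det_mul_row, Matrix.det_mul_column,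
      Matrix.det_vandermonde, vandermonde]
  have hrow : ∀ k : Fin (N + 1), (E * V) 0 k = if k = Fin.last N then 1 else 0 := by
    intro k
    have h := sum_nodalWeight_mul_pow y hy k (Nat.lt_succ_iff.mp k.isLt)
    rw [Matrix.mul_apply, if_congr (Fin.ext_iff (b := Fin.last N)) rfl rfl, Fin.val_last, ← h]
    refine sum_congr rfl fun j _ => ?_
    have h1 := sub_ne_zero.mpr (ha j)
    have h2 := sub_ne_zero.mpr (hat j)
    simp only [hE, hV, hM, Matrix.of_apply, Fin.cons_zero, Matrix.vandermonde_apply]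
    rw [mul_one_div_cancel (mul_ne_zero h1 h2), one_mul]
  rw [Matrix.det_succ_row_zero, sum_eq_single (Fin.last N)] at hdet
  · rw [hrow, if_pos rfl, mul_one, Fin.val_last] at hdet
    have hsub : (E * V).submatrix Fin.succ (Fin.last N).succAbove
        = Matrix.of fun i k : Fin N => ∑ j, 1 / ((X i - y j) * (X i - t * y j)) *
          ((a - y j) * (a - t * y j)) * (Lagrange.nodalWeight univ y j * y j ^ (k : ℕ)) := by
      ext i k
      rw [Matrix.submatrix_apply, Matrix.mul_apply, Matrix.of_apply, Fin.succAbove_last]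
      refine sum_congr rfl fun j _ => ?_
      simp only [hE, hV, hM, Matrix.of_apply, Fin.cons_succ, Matrix.vandermonde_apply,
        Fin.val_castSucc]
      ring
    rw [← hsub, mul_assoc ((-1) ^ N), mul_assoc ((-1) ^ N), ← hdet, ← mul_assoc, ← pow_add,
      Even.neg_one_pow ⟨_, rfl⟩, one_mul]
  · intro k _ hk
    rw [hrow, if_neg hk]
    ring
  · simp

theorem vandermonde_cons {K : Type*} [Field K] {N : ℕ} (a : K) (X : Fin N → K) :
    vandermonde (Fin.cons a X : Fin (N + 1) → K) = (∏ i, (X i - a)) * vandermonde X := by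
  simp [vandermonde, Fin.prod_univ_succ, Fin.prod_Ioi_succ]

theorem vandermonde_ne_zero {K : Type*} [Field K] {n : ℕ} {x : Fin n → K}
    (hx : Function.Injective x) : vandermonde x ≠ 0 := by
  have h := Matrix.det_vandermonde_ne_zero_iff.mpr hx
  rwa [Matrix.det_vandermonde] at h

/-- Multiplying row `i` by `a - X_i` makes the partial fraction identity applicable. The product of
these factors is, up to sign, the part of `Δ(a, X)` involving `a`, so it cancels against the
denominator of `gaudinF`. -/
theorem det_eq_gaudinF {K : Type*} [Field K] {N : ℕ} (y : Fin (N + 1) → K)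
    (hy : Function.Injective y) (t : K) (ht : t ≠ 0) (a : K) (X : Fin N → K)
    (hX : Function.Injective X) (haX : ∀ i, a ≠ X i) (ha : ∀ j, a ≠ y j)
    (hat : ∀ j, a ≠ t * y j) (hXy : ∀ i j, X i ≠ y j) (hXt : ∀ i j, X i ≠ t * y j) :
    (Matrix.of fun i k : Fin N => t ^ N * (t * a - X i) * (∏ j, (X i - y j)) * X i ^ (k : ℕ)
        - t ^ (k : ℕ) * (a - t * X i) * (∏ j, (X i - t * y j)) * X i ^ (k : ℕ)).det
      = vandermonde X * ((1 - t) ^ N * (-1) ^ N.choose 2 * t ^ N.choose 2 * (∏ i, X i) *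
        gaudinF t 1 (Fin.cons a X : Fin (N + 1) → K) y) := by
  have hne : ∏ i, (a - X i) ≠ 0 := prod_ne_zero_iff.mpr fun i _ => sub_ne_zero.mpr (haX i)
  have h1 := Matrix.det_mul_column (fun i => a - X i)
    (Matrix.of fun i k : Fin N => t ^ N * (t * a - X i) * (∏ j, (X i - y j)) * X i ^ (k : ℕ)
        - t ^ (k : ℕ) * (a - t * X i) * (∏ j, (X i - t * y j)) * X i ^ (k : ℕ))
  simp only [Matrix.of_apply] at h1
  simp only [fun (i k : Fin N) =>
    sub_mul_row_eq y hy t ht k k.isLt a (X i) (hXy i) (hXt i)] at h1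
  have h2 := Matrix.det_mul_row (fun k : Fin N => (t - 1) * t ^ (k : ℕ))
    (Matrix.of fun i k : Fin N => ((∏ j, (X i - y j)) * (∏ j, (X i - t * y j)) * X i) *
        ∑ j, 1 / ((X i - y j) * (X i - t * y j)) * ((a - y j) * (a - t * y j)) *
          (Lagrange.nodalWeight univ y j * y j ^ (k : ℕ)))
  have h3 := Matrix.det_mul_column
    (fun i : Fin N => (∏ j, (X i - y j)) * (∏ j, (X i - t * y j)) * X i)
    (Matrix.of fun i k : Fin N =>
        ∑ j, 1 / ((X i - y j) * (X i - t * y j)) * ((a - y j) * (a - t * y j)) *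
          (Lagrange.nodalWeight univ y j * y j ^ (k : ℕ)))
  simp only [Matrix.of_apply] at h2 h3
  rw [h2, h3, det_sum_nodalWeight y hy t a X ha hat] at h1
  have hpow : ∏ k : Fin N, ((t - 1) * t ^ (k : ℕ)) = (t - 1) ^ N * t ^ N.choose 2 := by
    rw [prod_mul_distrib, prod_const, card_univ, Fintype.card_fin,
      Fin.prod_univ_eq_prod_range (fun k => t ^ k), prod_pow_eq_pow_sum, sum_range_id,
      Nat.choose_two_right]
  have hres : resultant (Fin.cons a X : Fin (N + 1) → K) (scaledAlphabet t 1 y)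
      = (∏ j, ((a - y j) * (a - t * y j))) *
        ∏ i, ((∏ j, (X i - y j)) * ∏ j, (X i - t * y j)) := by
    rw [resultant, Fin.prod_univ_succ]
    simp [scaledAlphabet, Fintype.prod_prod_type, Fin.prod_univ_two, prod_mul_distrib]
  have hmat : (Matrix.of fun i j : Fin (N + 1) => 1 / ∏ k ∈ range (1 + 1),
        ((Fin.cons a X : Fin (N + 1) → K) i - t ^ k * y j))
      = Matrix.of fun i j : Fin (N + 1) =>
          1 / (((Fin.cons a X : Fin (N + 1) → K) i - y j) *
            ((Fin.cons a X : Fin (N + 1) → K) i - t * y j)) := by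
    simp [prod_range_succ]
  have hw := prod_nodalWeight_mul_vandermonde_sq y hy
  have hvy := vandermonde_ne_zero hy
  have hvX := vandermonde_ne_zero hX
  have hflip : ∏ i, (X i - a) = (-1) ^ N * ∏ i, (a - X i) := by
    rw [show ((-1 : K)) ^ N = ∏ _i : Fin N, (-1 : K) by simp, ← prod_mul_distrib]
    exact prod_congr rfl fun i _ => by ring
  have hsign : ((-1 : K)) ^ (N + 1).choose 2 = (-1) ^ N * (-1) ^ N.choose 2 := by
    rw [Nat.choose_succ_succ' N 1, Nat.choose_one_right, pow_add]
  have hpm : (t - 1) ^ N = (-1) ^ N * (1 - t) ^ N := by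
    rw [← mul_pow]; ring
  apply mul_left_cancel₀ hne
  rw [← h1, gaudinF, hres, hmat, vandermonde_cons, hflip, hpow, hpm]
  simp only [prod_mul_distrib]
  have hw' : (∏ j, Lagrange.nodalWeight univ y j) * vandermonde y
      = (-1) ^ N * (-1) ^ N.choose 2 / vandermonde y := by
    rw [eq_div_iff hvy, mul_assoc, hw, hsign]
  have hneg : ((-1 : K)) ^ N ≠ 0 := pow_ne_zero _ (by simp)
  rw [hw']
  field_simp
  rw [show (((-1 : K)) ^ N) ^ 4 = 1 by rw [← pow_mul, mul_comm, pow_mul]; norm_num, one_mul]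

/-! ### Divided differences -/

theorem sum_div_prod_sub_comp {ι K : Type*} [DecidableEq ι] [Field K] (S : Finset ι)
    (σ : Equiv.Perm ι) (x c : ι → K) :
    ∑ i ∈ S, c (σ i) / ∏ j ∈ S.erase i, (x (σ i) - x (σ j))
      = ∑ i ∈ S.image σ, c i / ∏ j ∈ (S.image σ).erase i, (x i - x j) := by
  rw [sum_image σ.injective.injOn]
  refine sum_congr rfl fun i _ => ?_
  rw [← image_erase σ.injective, prod_image σ.injective.injOn]

/-- Newton's recursion for divided differences, with arbitrary values `c i` at the nodes. -/
theorem sub_div_sum_div_prod_sub {ι K : Type*} [DecidableEq ι] [Field K] {x : ι → K}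
    (hx : Function.Injective x) (c : ι → K) (A : Finset ι) {p q : ι} (hp : p ∉ A) (hq : q ∉ A)
    (hpq : p ≠ q) :
    (∑ i ∈ insert p A, c i / ∏ j ∈ (insert p A).erase i, (x i - x j)
      - ∑ i ∈ insert q A, c i / ∏ j ∈ (insert q A).erase i, (x i - x j)) / (x p - x q)
      = ∑ i ∈ insert q (insert p A), c i /
          ∏ j ∈ (insert q (insert p A)).erase i, (x i - x j) := by
  have hsub : ∀ i j, i ≠ j → x i - x j ≠ 0 := fun i j h => sub_ne_zero.mpr (hx.ne h)
  have hpq' := hsub p q hpq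
  have hqp' := hsub q p hpq.symm
  have hprod : ∀ i ∉ A, ∏ j ∈ A, (x i - x j) ≠ 0 := fun i hi =>
    prod_ne_zero_iff.mpr fun j hj => hsub i j (by rintro rfl; exact hi hj)
  have hqi : q ∉ insert p A := by simp [hq, hpq.symm]
  rw [sum_insert hp, sum_insert hq, sum_insert hqi, sum_insert hp, erase_insert hp,
    erase_insert hq, erase_insert hqi, erase_insert_of_ne hpq.symm, erase_insert hp,
    prod_insert hq, prod_insert hp]
  have hA : ∀ i ∈ A, c i / ∏ j ∈ (insert q (insert p A)).erase i, (x i - x j)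
      = (c i / ∏ j ∈ (insert p A).erase i, (x i - x j)
        - c i / ∏ j ∈ (insert q A).erase i, (x i - x j)) / (x p - x q) := by
    intro i hi
    have hip : p ≠ i := by rintro rfl; exact hp hi
    have hiq : q ≠ i := by rintro rfl; exact hq hi
    have h1 := hsub i p hip.symm
    have h2 := hsub i q hiq.symm
    have h3 : ∏ j ∈ A.erase i, (x i - x j) ≠ 0 :=
      prod_ne_zero_iff.mpr fun j hj => hsub i j (mem_erase.mp hj).1.symm
    rw [erase_insert_of_ne hiq, erase_insert_of_ne hip, erase_insert_of_ne hiq,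
      prod_insert (by simp [hq, hpq.symm]), prod_insert (by simp [hp]), prod_insert (by simp [hq])]
    field_simp
    ring
  rw [sum_congr rfl hA, ← sum_div, sum_sub_distrib]
  have h1 := hprod p hp
  have h2 := hprod q hq
  have h3 : c q / ((x q - x p) * ∏ j ∈ A, (x q - x j))
      = -(c q / ∏ j ∈ A, (x q - x j)) / (x p - x q) := by
    field_simp
    ring
  have h4 : c p / ((x p - x q) * ∏ j ∈ A, (x p - x j))
      = (c p / ∏ j ∈ A, (x p - x j)) / (x p - x q) := by
    field_simp
  rw [h3, h4]
  ring

/-- A permutation of the letters permutes the values `f(x_i) ∏_{j≠i} x_j` in the same way, so they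
behave as the values of a one-variable function at the nodes. Writing the product over `j ≠ i`
avoids dividing by a letter that may be zero. -/
theorem dividedDiffProd_eq_sum {K : Type*} [Field K] {N : ℕ} (f : K → K) (m : ℕ) (hm : m ≤ N)
    (x : Fin (N + 1) → K) (hx : Function.Injective x) :
    dividedDiffProd (fun z : Fin (N + 1) → K =>
        f (z 0) * ∏ i : {i : Fin (N + 1) // i ≠ 0}, z i) m x
      = ∑ i ∈ univ.filter (fun i : Fin (N + 1) => (i : ℕ) < m + 1),
          (f (x i) * ∏ j ∈ univ.erase i, x j) /
            ∏ j ∈ (univ.filter fun i : Fin (N + 1) => (i : ℕ) < m + 1).erase i, (x i - x j) := by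
  induction m generalizing x with
  | zero =>
    have h : (univ.filter fun i : Fin (N + 1) => (i : ℕ) < 0 + 1) = {0} := by
      ext i
      simp only [mem_filter, mem_univ, true_and, mem_singleton, Fin.ext_iff, Fin.val_zero]
      omega
    rw [h, sum_singleton, dividedDiffProd]
    have h2 : ∏ i : {i : Fin (N + 1) // i ≠ 0}, x i = ∏ i ∈ univ.erase (0 : Fin (N + 1)), x i :=
      (prod_subtype (univ.erase (0 : Fin (N + 1))) (by simp) fun i : Fin (N + 1) => x i).symm
    simp [h2]
  | succ m ih =>
    set p : Fin (N + 1) := Fin.ofNat (N + 1) m with hp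
    set q : Fin (N + 1) := Fin.ofNat (N + 1) (m + 1) with hq
    have hpv : (p : ℕ) = m := Nat.mod_eq_of_lt (by omega)
    have hqv : (q : ℕ) = m + 1 := Nat.mod_eq_of_lt (by omega)
    have hpq : p ≠ q := fun h => by rw [Fin.ext_iff] at h; omega
    set A := univ.filter fun i : Fin (N + 1) => (i : ℕ) < m with hA
    have hpA : p ∉ A := by simp [hA, hpv]
    have hqA : q ∉ A := by simp [hA, hqv]
    have h1 : (univ.filter fun i : Fin (N + 1) => (i : ℕ) < m + 1) = insert p A := by
      ext i
      simp only [hA, mem_filter, mem_insert, mem_univ, true_and, Fin.ext_iff, hpv]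
      omega
    have h2 : (univ.filter fun i : Fin (N + 1) => (i : ℕ) < m + 1 + 1)
        = insert q (insert p A) := by
      ext i
      simp only [hA, mem_filter, mem_insert, mem_univ, true_and, Fin.ext_iff, hpv, hqv]
      omega
    have h3 : (insert p A).image (Equiv.swap p q) = insert q A := by
      rw [image_insert, Equiv.swap_apply_left]
      congr 1
      rw [image_congr (g := id), image_id]
      intro i hi
      exact Equiv.swap_apply_of_ne_of_ne (by rintro rfl; exact hpA hi)
        (by rintro rfl; exact hqA hi)
    have h4 : ∀ i, ∏ j ∈ univ.erase i, x (Equiv.swap p q j)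
        = ∏ j ∈ univ.erase (Equiv.swap p q i), x j := by
      intro i
      rw [← prod_image (g := Equiv.swap p q) (Equiv.injective _).injOn,
        image_erase (Equiv.injective _), image_univ_equiv]
    rw [dividedDiffProd, dividedDiff, ih (by omega) x hx,
      ih (by omega) _ (hx.comp (Equiv.injective _)), h1, h2,
      ← sub_div_sum_div_prod_sub hx _ A hpA hqA hpq, ← h3, ← sum_div_prod_sub_comp]
    simp only [Function.comp_apply, ← hp, ← hq, h4]

/-! ### Symmetry of the Gaudin function and comparison of coefficients -/

theorem vandermonde_comp_perm {K : Type*} [Field K] {n : ℕ} (x : Fin n → K)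
    (σ : Equiv.Perm (Fin n)) :
    vandermonde (x ∘ σ) = ((Equiv.Perm.sign σ : ℤ) : K) * vandermonde x := by
  have h := Matrix.det_permute σ (Matrix.vandermonde x)
  rw [Matrix.det_vandermonde] at h
  rw [vandermonde, vandermonde, ← h, ← Matrix.det_vandermonde]
  rfl

theorem gaudinF_comp_perm {K : Type*} [Field K] {n : ℕ} (t : K) (r : ℕ) (x y : Fin n → K)
    (σ : Equiv.Perm (Fin n)) : gaudinF t r (x ∘ σ) y = gaudinF t r x y := by
  have h := Matrix.det_permute σ
    (Matrix.of fun i j : Fin n => 1 / ∏ k ∈ range (r + 1), (x i - t ^ k * y j))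
  have hres : resultant (x ∘ σ) (scaledAlphabet t r y) = resultant x (scaledAlphabet t r y) :=
    Equiv.prod_comp σ fun i => ∏ j, (x i - scaledAlphabet t r y j)
  have hsign : ((Equiv.Perm.sign σ : ℤ) : K) ≠ 0 := by
    rcases Int.units_eq_one_or (Equiv.Perm.sign σ) with h | h <;> simp [h]
  rw [gaudinF, gaudinF, hres, vandermonde_comp_perm, mul_assoc]
  have h' : (Matrix.of fun i j : Fin n =>
      1 / ∏ k ∈ range (r + 1), ((x ∘ σ) i - t ^ k * y j)).det = _ := h
  rw [h', ← mul_assoc, div_mul_eq_mul_div, mul_comm (resultant _ _), ← div_div_eq_mul_div]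
  field_simp

theorem mul_self_eq_choose_add_choose (N : ℕ) : N * N = N.choose 2 + (N + 1).choose 2 := by
  induction N with
  | zero => rfl
  | succ N ih =>
    have h1 : (N + 1).choose 2 = N + N.choose 2 := by
      rw [Nat.choose_succ_succ' N 1, Nat.choose_one_right]
    have h2 : (N + 1 + 1).choose 2 = N + 1 + (N + 1).choose 2 := by
      rw [Nat.choose_succ_succ' (N + 1) 1, Nat.choose_one_right]
    rw [h2]
    linarith

/-- The two factors have different sources: `(1-t)^m` comes from the determinant, the t-factorial
from the symmetrization. -/
theorem tFactorial_eq {K : Type*} [Field K] (t : K) (m : ℕ) :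
    tFactorial t m = (1 - t) ^ m * tNumberFactorial t m := by
  induction m with
  | zero => simp [tFactorial, tNumberFactorial]
  | succ m ih =>
    rw [tFactorial, prod_Icc_succ_top (Nat.le_add_left 1 m), ← tFactorial, ih, tNumberFactorial,
      tNumberFactorial, prod_range_succ, ← mul_neg_geom_sum t (m + 1), tNumber, pow_succ]
    ring

theorem sum_powerset_image_univ {ι R : Type*} [DecidableEq ι] [AddCommMonoid R] {N : ℕ}
    {X : Fin N → ι} (hX : Function.Injective X) (F : Finset ι → R) :
    ∑ A ∈ (univ.image X).powerset, F A = ∑ A : Finset (Fin N), F (A.image X) := by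
  refine (sum_nbij (fun A => A.image X) ?_ ?_ ?_ ?_).symm
  · intro A _
    exact mem_powerset.mpr (image_subset_image (subset_univ _))
  · exact (image_injective hX).injOn
  · intro B hB
    obtain ⟨A, -, rfl⟩ := subset_image_iff.mp (mem_powerset.mp hB)
    exact ⟨A, by simp, rfl⟩
  · intro A _
    rfl

theorem sum_subsets_eq_gaudinF {K : Type*} [Field K] {N : ℕ} (y : Fin (N + 1) → K)
    (hy : Function.Injective y) (t : K) (ht : t ≠ 0) (a : K) (X : Fin N → K)
    (hX : Function.Injective X) (haX : ∀ i, a ≠ X i) (ha : ∀ j, a ≠ y j)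
    (hat : ∀ j, a ≠ t * y j) (hXy : ∀ i j, X i ≠ y j) (hXt : ∀ i j, X i ≠ t * y j) :
    ∑ A : Finset (Fin N), (-1) ^ A.card * t ^ (A.card + 1).choose 2 *
        ((∏ i ∈ A, (∏ j, (X i * t⁻¹ - y j)) * ((t * X i - a) / (X i - a))) *
          (∏ i ∈ Aᶜ, (∏ j, (X i - y j)) * ((t * a - X i) / (a - X i))) *
          ∏ i ∈ A, ∏ j ∈ Aᶜ, (t * X i - X j) / (X i - X j))
      = (∏ i, X i) / (∏ i, (a - X i)) * gaudinF t 1 (Fin.cons a X : Fin (N + 1) → K) y *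
        ((-1) ^ N.choose 2 * (t ^ (N + 1).choose 2)⁻¹ * (1 - t) ^ N) := by
  -- These are the weights of the letters inside and outside `A`, cleared of `a - X_i` and of powers
  -- of `t`; they are also the two halves of the rows in `det_eq_gaudinF`.
  set u : Fin N → K := fun i => -((a - t * X i) * ∏ j, (X i - t * y j)) with hu
  set v : Fin N → K := fun i => t ^ N * (t * a - X i) * ∏ j, (X i - y j) with hv
  have hdet := det_eq_gaudinF y hy t ht a X hX haX ha hat hXy hXt
  have hmat : (Matrix.of fun i k : Fin N =>
        t ^ N * (t * a - X i) * (∏ j, (X i - y j)) * X i ^ (k : ℕ)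
        - t ^ (k : ℕ) * (a - t * X i) * (∏ j, (X i - t * y j)) * X i ^ (k : ℕ))
      = Matrix.of fun i k : Fin N => u i * (t * X i) ^ (k : ℕ) + v i * X i ^ (k : ℕ) := by
    ext i k
    simp only [Matrix.of_apply, hu, hv, mul_pow]
    ring
  rw [hmat, det_add_scaled t X u v hX] at hdet
  have hsum := mul_left_cancel₀ (vandermonde_ne_zero hX) hdet
  have hne : ∀ i, a - X i ≠ 0 := fun i => sub_ne_zero.mpr (haX i)
  have hU : ∀ i, (∏ j, (X i * t⁻¹ - y j)) * ((t * X i - a) / (X i - a))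
      = (-(t ^ (N + 1))⁻¹) * (u i * (a - X i)⁻¹) := by
    intro i
    have h1 : ∀ j, X i * t⁻¹ - y j = t⁻¹ * (X i - t * y j) := fun j => by field_simp
    have h2 : X i - a ≠ 0 := sub_ne_zero.mpr (haX i).symm
    have h3 := hne i
    simp only [h1, prod_mul_distrib, prod_const, card_univ, Fintype.card_fin, hu, inv_pow]
    rw [div_eq_iff h2 |>.mpr (show t * X i - a = (a - t * X i) * (a - X i)⁻¹ * (X i - a) by
      field_simp; ring)]
    ring
  have hV : ∀ i, (∏ j, (X i - y j)) * ((t * a - X i) / (a - X i))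
      = (t ^ N)⁻¹ * (v i * (a - X i)⁻¹) := by
    intro i
    simp only [hv]
    field_simp
  have hpow : (t ^ N.choose 2) * ((t ^ N)⁻¹) ^ N = (t ^ (N + 1).choose 2)⁻¹ := by
    rw [inv_pow, ← pow_mul, mul_self_eq_choose_add_choose, pow_add]
    field_simp
  have hterm : ∀ A : Finset (Fin N), (-1) ^ A.card * t ^ (A.card + 1).choose 2 *
        ((∏ i ∈ A, (∏ j, (X i * t⁻¹ - y j)) * ((t * X i - a) / (X i - a))) *
          (∏ i ∈ Aᶜ, (∏ j, (X i - y j)) * ((t * a - X i) / (a - X i))) *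
          ∏ i ∈ A, ∏ j ∈ Aᶜ, (t * X i - X j) / (X i - X j))
      = ((t ^ N)⁻¹) ^ N * (∏ i, (a - X i))⁻¹ * ((∏ i ∈ A, u i) * (∏ i ∈ Aᶜ, v i) *
        (t ^ A.card.choose 2 * ∏ i ∈ A, ∏ j ∈ Aᶜ, (t * X i - X j) / (X i - X j))) := by
    intro A
    have hchoose : (A.card + 1).choose 2 = A.card + A.card.choose 2 := by
      rw [Nat.choose_succ_succ' A.card 1, Nat.choose_one_right]
    have hcard : ((t ^ N)⁻¹) ^ N = ((t ^ N)⁻¹) ^ A.card * ((t ^ N)⁻¹) ^ Aᶜ.card := by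
      rw [← pow_add, card_add_card_compl, Fintype.card_fin]
    -- The sign and `t^|A|`, split off from `t^((|A|+1).choose 2)`, make the scalar per letter
    -- `t^(-N)` both inside and outside `A`.
    have hscal : (-1) ^ A.card * t ^ A.card * (-(t ^ (N + 1))⁻¹) ^ A.card
        = ((t ^ N)⁻¹) ^ A.card := by
      rw [← mul_pow, ← mul_pow]
      congr 1
      rw [pow_succ]
      field_simp
    rw [prod_congr rfl fun i _ => hU i, prod_congr rfl fun i _ => hV i]
    simp only [prod_mul_distrib, prod_const]
    rw [hchoose, pow_add, hcard, ← hscal, ← prod_inv_distrib,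
      ← prod_mul_prod_compl A fun i => (a - X i)⁻¹]
    ring
  rw [sum_congr rfl fun A _ => hterm A, ← mul_sum, hsum, ← hpow]
  ring

end Gaudin

theorem theorem3 {K : Type*} [Field K] (n : ℕ) [NeZero n] (t : K) (ht : t ≠ 0)
    (f : K → K) (x y : Fin n → K)
    (hx : Function.Injective x) (hy : Function.Injective y)
    (hxy : ∀ i j, x i ≠ y j) (hxty : ∀ i j, x i ≠ t * y j) :
    Gaudin.eulerPoincare t
        (Gaudin.thetaProd t
          (fun z : Fin n → K =>
            f (z 0) * Gaudin.resultant (fun i : {i : Fin n // i ≠ 0} => z i) y)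
          (n - 1)) x
      = Gaudin.dividedDiffProd
          (fun z : Fin n → K => f (z 0) * ∏ i : {i : Fin n // i ≠ 0}, z i) (n - 1) x
        * Gaudin.gaudinF t 1 x y
        * ((-1) ^ (n - 1).choose 2 * (t ^ n.choose 2)⁻¹ * Gaudin.tFactorial t (n - 1)) := by
  classical
  obtain ⟨N, rfl⟩ := Nat.exists_eq_succ_of_ne_zero (NeZero.ne n)
  simp only [Nat.succ_eq_add_one, Nat.add_sub_cancel]
  have hL := Gaudin.eulerPoincare_thetaProd (N := N) t f (fun a => ∏ j, (a - y j)) x hx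
  have hR := Gaudin.dividedDiffProd_eq_sum f N le_rfl x hx
  rw [Finset.filter_true_of_mem fun i _ => i.isLt] at hR
  refine hL.trans ?_
  refine Eq.trans ?_ (congrArg (fun d => d * Gaudin.gaudinF t 1 x y *
    ((-1) ^ N.choose 2 * (t ^ (N + 1).choose 2)⁻¹ * Gaudin.tFactorial t N)) hR.symm)
  rw [Finset.sum_image hx.injOn, Finset.sum_mul, Finset.sum_mul, Finset.mul_sum]
  refine Finset.sum_congr rfl fun p _ => ?_
  -- The alphabet `x - x_p`, listed so that putting `x_p` in front gives a permutation of `x`;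
  -- symmetry of `gaudinF` then applies.
  set X : Fin N → K := fun i => x (Equiv.swap 0 p i.succ) with hX
  have hXinj : Function.Injective X := Gaudin.injective_comp_swap_succ hx p
  have hcons : (Fin.cons (x p) X : Fin (N + 1) → K) = x ∘ Equiv.swap 0 p := by
    funext i
    refine Fin.cases ?_ (fun i => ?_) i
    · simp
    · simp [hX]
  have hpX : ∀ i, x p ≠ X i := by
    intro i h
    have h1 := congrArg (Equiv.swap 0 p) (hx h)
    rw [Equiv.swap_apply_self, Equiv.swap_apply_right] at h1
    exact Fin.succ_ne_zero i h1.symm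
  have hkey := Gaudin.sum_subsets_eq_gaudinF y hy t ht (x p) X hXinj hpX (hxy p) (hxty p)
    (fun i => hxy _) (fun i => hxty _)
  rw [hcons, Gaudin.gaudinF_comp_perm] at hkey
  have herase : Finset.univ.erase p
      = Finset.univ.image fun i : Fin N => Equiv.swap 0 p i.succ := by
    have h := Gaudin.image_erase_eq_image_swap_succ (x := id) Function.injective_id p
    simpa using h
  have hprod : ∀ G : Fin (N + 1) → K, ∏ j ∈ Finset.univ.erase p, G j
      = ∏ i : Fin N, G (Equiv.swap 0 p i.succ) := by
    intro G
    have hinj : Function.Injective fun i : Fin N => Equiv.swap 0 p i.succ :=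
      Gaudin.injective_comp_swap_succ (x := id) Function.injective_id p
    rw [herase, Finset.prod_image hinj.injOn]
  have hset : ∀ A : Finset (Fin N), Finset.univ.image X \ A.image X = Aᶜ.image X := by
    intro A
    rw [← Finset.image_sdiff _ _ hXinj, Finset.compl_eq_univ_sdiff]
  rw [Gaudin.image_erase_eq_image_swap_succ hx p, Gaudin.sum_powerset_image_univ hXinj, hprod,
    hprod, Gaudin.tFactorial_eq]
  simp only [← hX, hset, Finset.prod_image hXinj.injOn, Finset.card_image_of_injective _ hXinj]
  rw [hkey]
  ring
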